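/- An \emph{overring} of an integral domain $R$ is a ring $S$ with $R \subseteq S \subseteq \operatorname{Frac}(R)$. Call $R$ \emph{globally perinormal} if every overring $S$ of $R$ such that the inclusion $R \subseteq S$ satisfies going-down is of the form $S = R_W$ for some multiplicative set $W \subseteq R$. Call $R$ a \emph{Krull domain} if $R = \bigcap_{\mathfrak p} R_{\mathfrak p}$, where $\mathfrak p$ ranges over the height one primes of $R$, every nonzero element of $R$ lies in only finitely many height one primes, and $R_{\mathfrak p}$ is a discrete valuation ring for every height one prime $\mathfrak p$. The \emph{divisor class group} $\operatorname{Cl}(R)$ of a Krull domain $R$ is the free abelian group on the height one primes of $R$ modulo the subgroup of principal divisors $\operatorname{div}(x) = \sum_{\mathfrak p} v_{\mathfrak p}(x)\,\mathfrak p$, $x \in \operatorname{Frac}(R)^\times$, where $v_{\mathfrak p}$ is the normalized discrete valuation with valuation ring $R_{\mathfrak p}$. \textbf{Theorem.} Let $R$ be a Krull domain. (1) If $\operatorname{Cl}(R)$ is a torsion group, then $R$ is globally perinormal. (2) Conversely, if $\dim R = 1$ and $R$ is globally perinormal, then $\operatorname{Cl}(R)$ is a torsion group. -/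

import Mathlib

open scoped nonZeroDivisors

section Perinormal

variable (R : Type*) [CommRing R] [IsDomain R]

/-- An integral domain `R` is *globally perinormal* if every overring `S` of `R` (a ring between
`R` and its fraction field) such that `R ⊆ S` satisfies going-down is a localization of `R` at a
multiplicative set. -/
def IsGloballyPerinormal : Prop :=
  ∀ S : Subalgebra R (FractionRing R), Algebra.HasGoingDown R S →
    ∃ W : Submonoid R, IsLocalization W S

/-- The set of prime ideals of `R` of height one. -/
def HeightOnePrime : Type _ := {p : PrimeSpectrum R // p.asIdeal.height = 1}

variable {R}

/-- The localization of `R` at a height one prime, as a subring of the fraction field. -/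
noncomputable def HeightOnePrime.localRing (p : HeightOnePrime R) :
    Subalgebra R (FractionRing R) :=
  Localization.subalgebra.ofField (FractionRing R) p.1.asIdeal.primeCompl
    p.1.asIdeal.primeCompl_le_nonZeroDivisors

variable (R)

/-- A domain `R` is a *Krull domain* if it is the intersection (in its fraction field) of its
localizations at height one primes, every nonzero element lies in only finitely many height one
primes, and the localizations at height one primes are discrete valuation rings. -/
class IsKrullDomain : Prop where
  iInf_localRing : ⨅ p : HeightOnePrime R, p.localRing = ⊥
  finite_setOf_mem : ∀ r : R, r ≠ 0 → {p : HeightOnePrime R | r ∈ p.1.asIdeal}.Finite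
  isDiscreteValuationRing : ∀ p : HeightOnePrime R, IsDiscreteValuationRing p.localRing

end Perinormal

namespace HeightOnePrime

variable {R : Type*} [CommRing R] [IsDomain R] [IsKrullDomain R]

instance (p : HeightOnePrime R) : IsDiscreteValuationRing p.localRing :=
  IsKrullDomain.isDiscreteValuationRing p

/-- The (multiplicative, normalized) discrete valuation of the fraction field with valuation ring
the localization at `p`. -/
noncomputable def valuation (p : HeightOnePrime R) :
    Valuation (FractionRing R) (WithZero (Multiplicative ℤ)) :=
  IsDedekindDomain.HeightOneSpectrum.valuation (R := p.localRing) (FractionRing R)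
    ⟨IsLocalRing.maximalIdeal p.localRing, inferInstance,
      IsDiscreteValuationRing.not_a_field p.localRing⟩

/-- The order of `x` at `p`; the additive form of the valuation, so that the generator of the
maximal ideal of the localization at `p` has order `1`. -/
noncomputable def ord (p : HeightOnePrime R) (x : (FractionRing R)ˣ) : ℤ :=
  -WithZero.log (p.valuation (x : FractionRing R))

theorem ord_one (p : HeightOnePrime R) : p.ord 1 = 0 := by
  simp [ord]

theorem ord_mul (p : HeightOnePrime R) (x y : (FractionRing R)ˣ) :
    p.ord (x * y) = p.ord x + p.ord y := by
  have hx : p.valuation (x : FractionRing R) ≠ 0 := (Valuation.ne_zero_iff _).2 x.ne_zero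
  have hy : p.valuation (y : FractionRing R) ≠ 0 := (Valuation.ne_zero_iff _).2 y.ne_zero
  simp only [ord, Units.val_mul, map_mul, WithZero.log_mul hx hy]
  ring

theorem valuation_eq_one_of_notMem (p : HeightOnePrime R) {r : R} (hr : r ∉ p.1.asIdeal) :
    p.valuation (algebraMap R (FractionRing R) r) = 1 := by
  have : IsLocalization p.1.asIdeal.primeCompl p.localRing :=
    Localization.subalgebra.isLocalization_ofField _ _ _
  have hu : IsUnit (algebraMap R p.localRing r) :=
    IsLocalization.map_units p.localRing (⟨r, hr⟩ : p.1.asIdeal.primeCompl)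
  rw [IsScalarTower.algebraMap_apply R p.localRing (FractionRing R), valuation,
    IsDedekindDomain.HeightOneSpectrum.valuation_eq_one_iff_notMem]
  simpa [IsLocalRing.mem_maximalIdeal] using hu

theorem finite_support_ord (x : (FractionRing R)ˣ) :
    (Function.support fun p : HeightOnePrime R => p.ord x).Finite := by
  obtain ⟨a, b, hb, hx⟩ := IsFractionRing.div_surjective R (x : FractionRing R)
  have hb0 : b ≠ 0 := nonZeroDivisors.ne_zero hb
  have ha0 : a ≠ 0 := by
    rintro rfl
    exact x.ne_zero (by rw [← hx]; simp)
  refine ((IsKrullDomain.finite_setOf_mem a ha0).union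
    (IsKrullDomain.finite_setOf_mem b hb0)).subset fun p hp => ?_
  by_contra h
  simp only [Set.mem_union, Set.mem_ofPred_eq, not_or] at h
  apply hp
  simp only [ord, ← hx, map_div₀, p.valuation_eq_one_of_notMem h.1,
    p.valuation_eq_one_of_notMem h.2]
  simp

end HeightOnePrime

section DivisorClassGroup

variable (R : Type*) [CommRing R] [IsDomain R] [IsKrullDomain R]

/-- The homomorphism sending a nonzero element `x` of the fraction field of a Krull domain to its
principal divisor `∑ p, ord p x • p` in the free abelian group on the height one primes. -/
noncomputable def principalDivisor :
    Additive (FractionRing R)ˣ →+ (HeightOnePrime R →₀ ℤ) where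
  toFun x := Finsupp.ofSupportFinite (fun p => p.ord x.toMul)
    (HeightOnePrime.finite_support_ord x.toMul)
  map_zero' := by
    ext p
    exact p.ord_one
  map_add' x y := by
    ext p
    exact p.ord_mul x.toMul y.toMul

/-- The *divisor class group* of a Krull domain: the free abelian group on the height one primes
modulo the principal divisors. -/
abbrev DivisorClassGroup : Type _ :=
  (HeightOnePrime R →₀ ℤ) ⧸ (principalDivisor R).range

end DivisorClassGroup

open scoped WithZero

namespace HeightOnePrime

/-! Torsion implies perinormal: given `s` in a going-down overring `S`, a positive multiple of the
pole divisor of `s` is `div w` with `w ∈ R`, and `s * w ∈ R`. If `w` were a nonunit of `S`, some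
maximal ideal of `S` would contract to a prime containing a height one `q ∋ w`. Going-down puts a
prime of `S` over `q`, so `S ⊆ R_q`; then `s` has no pole at `q`, contradicting `w ∈ q`.

Converse: in dimension one every overring has going-down, so the intersection of all `R_q` with `q ≠
p` is some `R_W`. It contains an element with a pole at `p`, whose denominator in `W` has divisor a
positive multiple of `p`. -/

theorem eq_of_le {R : Type*} [CommRing R] {p q : HeightOnePrime R} (h : q.1.asIdeal ≤ p.1.asIdeal) : q = p := by
  by_contra hne
  have hlt : q.1.asIdeal < p.1.asIdeal :=
    lt_of_le_of_ne h fun he => hne (Subtype.ext (PrimeSpectrum.ext he))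
  have : p.1.asIdeal.FiniteHeight := ⟨.inr (by simp [p.2])⟩
  have := Ideal.height_strict_mono_of_isPrime_of_isPrime hlt
  simp [p.2, q.2] at this

variable {R : Type*} [CommRing R] [IsDomain R]

theorem mem_localRing_iff (p : HeightOnePrime R) (x : FractionRing R) :
    x ∈ p.localRing ↔ ∃ a s : R, s ∉ p.1.asIdeal ∧
      x = algebraMap R (FractionRing R) a * (algebraMap R (FractionRing R) s)⁻¹ := by
  constructor
  · rintro ⟨a, s, hs, rfl⟩
    exact ⟨a, s, hs, rfl⟩
  · rintro ⟨a, s, hs, rfl⟩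
    exact ⟨a, s, hs, rfl⟩

theorem asIdeal_ne_bot (p : HeightOnePrime R) : p.1.asIdeal ≠ ⊥ := by
  intro h
  have := p.2
  simp [h] at this

variable [IsKrullDomain R]

theorem valuation_le_one_iff (p : HeightOnePrime R) (x : FractionRing R) :
    p.valuation x ≤ 1 ↔ x ∈ p.localRing := by
  constructor
  · intro h
    obtain ⟨a, rfl⟩ := IsDiscreteValuationRing.exists_lift_of_le_one (A := p.localRing) h
    exact a.2
  · intro h
    exact IsDedekindDomain.HeightOneSpectrum.valuation_le_one _ (⟨x, h⟩ : p.localRing)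

theorem valuation_algebraMap_le_one (p : HeightOnePrime R) (r : R) :
    p.valuation (algebraMap R (FractionRing R) r) ≤ 1 :=
  (p.valuation_le_one_iff _).2 (p.localRing.algebraMap_mem r)

theorem valuation_lt_one_iff_mem (p : HeightOnePrime R) (r : R) :
    p.valuation (algebraMap R (FractionRing R) r) < 1 ↔ r ∈ p.1.asIdeal := by
  have : IsLocalization p.1.asIdeal.primeCompl p.localRing :=
    Localization.subalgebra.isLocalization_ofField _ _ _
  rw [IsScalarTower.algebraMap_apply R p.localRing (FractionRing R), valuation,
    IsDedekindDomain.HeightOneSpectrum.valuation_lt_one_iff_mem, IsLocalRing.mem_maximalIdeal,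
    mem_nonunits_iff, IsLocalization.AtPrime.isUnit_to_map_iff p.localRing p.1.asIdeal]
  simp [Ideal.primeCompl]

theorem ord_nonneg_iff (p : HeightOnePrime R) (x : (FractionRing R)ˣ) :
    0 ≤ p.ord x ↔ p.valuation (x : FractionRing R) ≤ 1 := by
  have hx : p.valuation (x : FractionRing R) ≠ 0 := (Valuation.ne_zero_iff _).2 x.ne_zero
  rw [ord, Left.nonneg_neg_iff, ← WithZero.log_one, WithZero.log_le_log hx one_ne_zero]

theorem ord_pos_iff (p : HeightOnePrime R) (x : (FractionRing R)ˣ) :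
    0 < p.ord x ↔ p.valuation (x : FractionRing R) < 1 := by
  have hx : p.valuation (x : FractionRing R) ≠ 0 := (Valuation.ne_zero_iff _).2 x.ne_zero
  rw [ord, Left.neg_pos_iff, ← WithZero.log_one, WithZero.log_lt_log hx one_ne_zero]

end HeightOnePrime

namespace IsKrullDomain

variable {R : Type*} [CommRing R] [IsDomain R] [IsKrullDomain R]

theorem exists_algebraMap_eq_of_valuation_le_one {x : FractionRing R}
    (h : ∀ p : HeightOnePrime R, p.valuation x ≤ 1) :
    ∃ r, algebraMap R (FractionRing R) r = x := by
  have hx : x ∈ ⨅ p : HeightOnePrime R, p.localRing :=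
    Algebra.mem_iInf.2 fun p => (p.valuation_le_one_iff x).1 (h p)
  rw [iInf_localRing] at hx
  exact Algebra.mem_bot.1 hx

/-- A form of approximation: outside a prime `m`, some element has order at least that of `w` at
all height one primes not contained in `m`. -/
theorem exists_notMem_valuation_le (m : Ideal R) [m.IsPrime] {w : R} (hw : w ≠ 0) :
    ∃ b ∉ m, ∀ q : HeightOnePrime R, ¬ q.1.asIdeal ≤ m →
      q.valuation (algebraMap R (FractionRing R) b) ≤
        q.valuation (algebraMap R (FractionRing R) w) := by
  classical
  have key (q : HeightOnePrime R) : ∃ b ∉ m, ¬ q.1.asIdeal ≤ m →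
      q.valuation (algebraMap R (FractionRing R) b) ≤
        q.valuation (algebraMap R (FractionRing R) w) := by
    by_cases hq : q.1.asIdeal ≤ m
    · exact ⟨1, m.one_notMem, fun h => absurd hq h⟩
    obtain ⟨a, haq, ham⟩ := SetLike.not_le_iff_exists.1 hq
    have hw0 : q.valuation (algebraMap R (FractionRing R) w) ≠ 0 := by
      simpa using hw
    obtain ⟨n, hn⟩ := exists_pow_lt₀ ((q.valuation_lt_one_iff_mem a).2 haq) (Units.mk0 _ hw0)
    refine ⟨a ^ n, fun h => ham (Ideal.IsPrime.mem_of_pow_mem ‹_› n h), fun _ => ?_⟩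
    simpa using hn.le
  choose b hbm hb using key
  have hfin := finite_setOf_mem w hw
  -- Only the finitely many primes containing `w` impose a condition; at the others `w` has
  -- valuation `1`.
  refine ⟨∏ q ∈ hfin.toFinset, b q, fun h => ?_, fun q hq => ?_⟩
  · obtain ⟨q, -, hq⟩ := (Ideal.IsPrime.prod_mem_iff).1 h
    exact hbm q hq
  · by_cases hwq : w ∈ q.1.asIdeal
    · rw [← Finset.mul_prod_erase _ b (hfin.mem_toFinset.2 hwq), map_mul, map_mul]
      exact (mul_le_of_le_one_right' (q.valuation_algebraMap_le_one _)).trans (hb q hq)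
    · rw [q.valuation_eq_one_of_notMem hwq]
      exact q.valuation_algebraMap_le_one _

/-- A prime containing a nonzero element `w` contains a height one prime containing `w`. -/
theorem exists_heightOnePrime_le (m : Ideal R) [m.IsPrime] {w : R} (hw : w ≠ 0) (hwm : w ∈ m) :
    ∃ q : HeightOnePrime R, w ∈ q.1.asIdeal ∧ q.1.asIdeal ≤ m := by
  by_contra! h
  obtain ⟨b, hbm, hb⟩ := exists_notMem_valuation_le m hw
  have hw' : algebraMap R (FractionRing R) w ≠ 0 := by simpa using hw
  -- By `h` no height one prime containing `w` lies in `m`, so `b / w` has no poles. Hence `b ∈ wR ⊆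
  -- m`.
  obtain ⟨r, hr⟩ := exists_algebraMap_eq_of_valuation_le_one (R := R)
      (x := algebraMap R (FractionRing R) b / algebraMap R (FractionRing R) w) fun q => by
    rw [map_div₀]
    by_cases hq : w ∈ q.1.asIdeal
    · exact div_le_one_of_le₀ (hb q (h q hq)) zero_le
    · rw [q.valuation_eq_one_of_notMem hq, div_one]
      exact q.valuation_algebraMap_le_one _
  rw [eq_div_iff hw', ← map_mul] at hr
  exact hbm (IsFractionRing.injective R (FractionRing R) hr ▸ m.mul_mem_left r hwm)

/-- There is an element of the fraction field with a pole at `p` and nowhere else. -/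
theorem exists_one_lt_valuation (p : HeightOnePrime R) :
    ∃ x : FractionRing R, 1 < p.valuation x ∧
      ∀ q : HeightOnePrime R, q ≠ p → q.valuation x ≤ 1 := by
  obtain ⟨t, htp, ht⟩ := Submodule.exists_mem_ne_zero_of_ne_bot p.asIdeal_ne_bot
  obtain ⟨b, hbp, hb⟩ := exists_notMem_valuation_le p.1.asIdeal ht
  refine ⟨algebraMap R (FractionRing R) b / algebraMap R (FractionRing R) t, ?_, fun q hq => ?_⟩
  · have h0 : 0 < p.valuation (algebraMap R (FractionRing R) t) :=
      zero_lt_iff.2 (by simpa using ht)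
    rw [map_div₀, p.valuation_eq_one_of_notMem hbp, one_div, one_lt_inv₀ h0]
    exact (p.valuation_lt_one_iff_mem t).2 htp
  · rw [map_div₀]
    exact div_le_one_of_le₀ (hb q fun h => hq (HeightOnePrime.eq_of_le h)) zero_le

/-- An overring with a prime lying over `p` is contained in the localization at `p`. -/
theorem valuation_le_one_of_liesOver (p : HeightOnePrime R) {S : Subalgebra R (FractionRing R)}
    (P : Ideal S) [P.LiesOver p.1.asIdeal] (x : S) : p.valuation (x : FractionRing R) ≤ 1 := by
  by_contra! h
  have hx0 : (x : FractionRing R) ≠ 0 := by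
    intro h0
    simp [h0] at h
  have hinv : p.valuation (x : FractionRing R)⁻¹ ≤ 1 := by
    rw [map_inv₀]
    exact inv_le_one_of_one_le₀ h.le
  obtain ⟨a, s, hs, hxs⟩ := (p.mem_localRing_iff _).1 ((p.valuation_le_one_iff _).1 hinv)
  have hval : p.valuation (algebraMap R (FractionRing R) a) < 1 := by
    have h1 : p.valuation (x : FractionRing R)⁻¹ < 1 := by
      rw [map_inv₀]
      exact inv_lt_one_of_one_lt₀ h
    rwa [hxs, map_mul, map_inv₀, p.valuation_eq_one_of_notMem hs, inv_one, mul_one] at h1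
  have haP : algebraMap R S a ∈ P :=
    (Ideal.mem_of_liesOver P p.1.asIdeal a).1 ((p.valuation_lt_one_iff_mem a).1 hval)
  have hsP : algebraMap R S s = algebraMap R S a * x := by
    apply Subtype.ext
    change algebraMap R (FractionRing R) s = algebraMap R (FractionRing R) a * x
    rw [inv_eq_iff_eq_inv, mul_inv, inv_inv] at hxs
    have ha0 : algebraMap R (FractionRing R) a ≠ 0 := by
      intro h0
      simp [h0] at hxs
      exact hx0 (by simpa using hxs)
    rw [hxs]
    field_simp
  exact hs ((Ideal.mem_of_liesOver P p.1.asIdeal s).2 (hsP ▸ P.mul_mem_right x haP))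

theorem exists_pos_nsmul_eq_principalDivisor (h : IsAddTorsion (DivisorClassGroup R))
    (D : HeightOnePrime R →₀ ℤ) :
    ∃ n : ℕ, 0 < n ∧ ∃ x : (FractionRing R)ˣ, ∀ p, p.ord x = n * D p := by
  obtain ⟨n, hn, hD⟩ := isOfFinAddOrder_iff_nsmul_eq_zero.1
    (h (QuotientAddGroup.mk' (principalDivisor R).range D))
  rw [← map_nsmul, QuotientAddGroup.mk'_apply, QuotientAddGroup.eq_zero_iff] at hD
  obtain ⟨x, hx⟩ := hD
  refine ⟨n, hn, x.toMul, fun p => ?_⟩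
  have := DFunLike.congr_fun hx p
  rw [Finsupp.smul_apply, nsmul_eq_mul] at this
  exact this

theorem isGloballyPerinormal_of_isAddTorsion (h : IsAddTorsion (DivisorClassGroup R)) :
    IsGloballyPerinormal R := by
  intro S hS
  -- The largest possible `W`: all elements of `R` that become units in `S`.
  refine ⟨(IsUnit.submonoid S).comap (algebraMap R S), ⟨fun w => w.2, fun s => ?_,
    fun {a b} hab => ⟨1, ?_⟩⟩⟩
  · by_cases hs0 : s = 0
    · exact ⟨(0, 1), by simp [hs0]⟩
    have hsK : (s : FractionRing R) ≠ 0 := fun h0 => hs0 (Subtype.ext h0)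
    set x : (FractionRing R)ˣ := Units.mk0 _ hsK with hx
    -- `max 0 (-z)` extracts the pole divisor of `x`.
    obtain ⟨n, hn, y, hy⟩ := exists_pos_nsmul_eq_principalDivisor h
      ((principalDivisor R (.ofMul x)).mapRange (fun z => max 0 (-z)) (by simp))
    replace hy (p : HeightOnePrime R) : p.ord y = n * max 0 (-p.ord x) := hy p
    obtain ⟨w, hw⟩ := exists_algebraMap_eq_of_valuation_le_one (R := R) (x := y) fun p => by
      rw [← p.ord_nonneg_iff, hy]
      positivity
    have hn1 : (1 : ℤ) ≤ n := by exact_mod_cast hn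
    obtain ⟨r, hr⟩ := exists_algebraMap_eq_of_valuation_le_one (R := R) (x := (x * y :)) fun p => by
      rw [← p.ord_nonneg_iff, p.ord_mul, hy]
      nlinarith [le_max_right 0 (-p.ord x), le_max_left 0 (-p.ord x)]
    have hw0 : w ≠ 0 := by
      rintro rfl
      exact y.ne_zero (by simpa using hw.symm)
    have hunit : IsUnit (algebraMap R S w) := by
      by_contra hnu
      obtain ⟨M, hM, hwM⟩ := exists_max_ideal_of_mem_nonunits hnu
      obtain ⟨q, hwq, hqM⟩ := exists_heightOnePrime_le (M.under R) hw0 hwM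
      obtain ⟨P, -, -, hP⟩ := Ideal.exists_ideal_le_liesOver_of_le (p := q.1.asIdeal) M hqM
      have h1 : 0 ≤ q.ord x := (q.ord_nonneg_iff x).2 (valuation_le_one_of_liesOver q P s)
      have h2 : 0 < q.ord y := (q.ord_pos_iff y).2 (hw ▸ (q.valuation_lt_one_iff_mem w).2 hwq)
      rw [hy, max_eq_left (by simpa using h1)] at h2
      simp at h2
    refine ⟨(r, ⟨w, hunit⟩), Subtype.ext ?_⟩
    change (s : FractionRing R) * algebraMap R (FractionRing R) w = algebraMap R (FractionRing R) r
    rw [hr, hw]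
    simp [hx]
  · rw [IsFractionRing.injective R (FractionRing R) (congrArg Subtype.val hab)]

end IsKrullDomain

/-- A strict inclusion of primes must start at `⊥`, and `⊥` in `S` lies over it by injectivity. -/
theorem Algebra.HasGoingDown.of_krullDimLE_one {R S : Type*} [CommRing R] [IsDomain R]
    [Ring.KrullDimLE 1 R] [CommRing S] [IsDomain S] [Algebra R S] [FaithfulSMul R S] :
    Algebra.HasGoingDown R S where
  exists_ideal_le_liesOver_of_lt {p} _ Q _ hlt := by
    have hp : p = ⊥ := by
      by_contra hne
      have hmax := Ideal.isMaximal_of_isPrime_of_ne_bot p hne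
      exact hlt.ne (hmax.eq_of_le Ideal.IsPrime.ne_top' hlt.le)
    subst hp
    exact ⟨⊥, bot_le, Ideal.isPrime_bot, inferInstance⟩

namespace IsKrullDomain

variable {R : Type*} [CommRing R] [IsDomain R] [IsKrullDomain R]

/-- If the intersection of the localizations at the height one primes other than `p` is itself a
localization, then some multiple of `p` is a principal divisor. -/
theorem exists_pos_nsmul_single_eq_principalDivisor (p : HeightOnePrime R) {W : Submonoid R}
    (hW : IsLocalization W
      (⨅ q : {q : HeightOnePrime R // q ≠ p}, q.1.localRing : Subalgebra R (FractionRing R))) :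
    ∃ n : ℕ, 0 < n ∧ n • Finsupp.single p 1 ∈ (principalDivisor R).range := by
  classical
  set S : Subalgebra R (FractionRing R) := ⨅ q : {q : HeightOnePrime R // q ≠ p}, q.1.localRing
    with hSdef
  have hS {x : FractionRing R} : x ∈ S ↔ ∀ q : HeightOnePrime R, q ≠ p → q.valuation x ≤ 1 := by
    simp [hSdef, Algebra.mem_iInf, HeightOnePrime.valuation_le_one_iff]
  obtain ⟨x, hxp, hxq⟩ := exists_one_lt_valuation p
  obtain ⟨⟨r, w⟩, hrw⟩ := IsLocalization.surj W (⟨x, hS.2 hxq⟩ : S)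
  have hrw' : x * algebraMap R (FractionRing R) w = algebraMap R (FractionRing R) r :=
    congrArg Subtype.val hrw
  -- Otherwise `x * w = r` would still have a pole at `p`.
  have hwp : p.valuation (algebraMap R (FractionRing R) w) < 1 := by
    by_contra! hge
    have := p.valuation_algebraMap_le_one r
    rw [← hrw', map_mul] at this
    exact (one_lt_mul_of_lt_of_le hxp hge).not_ge this
  obtain ⟨u, hu⟩ := IsLocalization.map_units S w
  let y : (FractionRing R)ˣ := Units.map S.val.toRingHom.toMonoidHom u
  have hy : (y : FractionRing R) = algebraMap R (FractionRing R) w := congrArg Subtype.val hu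
  have hpos : 0 < p.ord y := (p.ord_pos_iff y).2 (hy ▸ hwp)
  -- Both `w` and its inverse lie in `S`, hence in `R_q`.
  have hzero (q : HeightOnePrime R) (hq : q ≠ p) : q.ord y = 0 := by
    have h1 : 0 ≤ q.ord y := (q.ord_nonneg_iff y).2 (hS.1 u.1.2 q hq)
    have h2 : 0 ≤ q.ord y⁻¹ := (q.ord_nonneg_iff y⁻¹).2 (hS.1 (u⁻¹).1.2 q hq)
    have h3 := q.ord_mul y y⁻¹
    rw [mul_inv_cancel, q.ord_one] at h3
    omega
  refine ⟨(p.ord y).toNat, by omega, .ofMul y, ?_⟩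
  ext q
  change q.ord y = _
  rw [Finsupp.smul_apply, nsmul_eq_mul, Int.toNat_of_nonneg hpos.le]
  by_cases hq : q = p
  · simp [hq]
  · rw [hzero q hq, Finsupp.single_eq_of_ne hq, mul_zero]

theorem isAddTorsion_of_isGloballyPerinormal (hdim : ringKrullDim R = 1)
    (h : IsGloballyPerinormal R) : IsAddTorsion (DivisorClassGroup R) := by
  have : Ring.KrullDimLE 1 R := (Order.krullDimLE_iff 1 _).2 hdim.le
  intro D
  -- Torsion classes form a subgroup, so the class of each single prime suffices.
  induction D using QuotientAddGroup.induction_on with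
  | H D =>
    induction D using Finsupp.induction_linear with
    | zero => exact IsOfFinAddOrder.zero
    | add f g hf hg => exact hf.add hg
    | single p z =>
      obtain ⟨W, hW⟩ := h _ (Algebra.HasGoingDown.of_krullDimLE_one (R := R)
        (S := (⨅ q : {q : HeightOnePrime R // q ≠ p}, q.1.localRing :
          Subalgebra R (FractionRing R))))
      obtain ⟨n, hn, hmem⟩ := exists_pos_nsmul_single_eq_principalDivisor p hW
      have h1 : IsOfFinAddOrder
          (QuotientAddGroup.mk (Finsupp.single p 1) : DivisorClassGroup R) :=
        isOfFinAddOrder_iff_nsmul_eq_zero.2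
          ⟨n, hn, (QuotientAddGroup.eq_zero_iff (n • Finsupp.single p (1 : ℤ))).2 hmem⟩
      have h2 := h1.zsmul (i := z)
      rwa [← QuotientAddGroup.mk_zsmul, Finsupp.smul_single, smul_eq_mul, mul_one] at h2

end IsKrullDomain

theorem mainTheorem4 (R : Type*) [CommRing R] [IsDomain R] [IsKrullDomain R] :
    (IsAddTorsion (DivisorClassGroup R) → IsGloballyPerinormal R) ∧
      (ringKrullDim R = 1 → IsGloballyPerinormal R → IsAddTorsion (DivisorClassGroup R)) :=
  ⟨IsKrullDomain.isGloballyPerinormal_of_isAddTorsion,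
    IsKrullDomain.isAddTorsion_of_isGloballyPerinormal⟩
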